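/- For an irrational point $\alpha\in\mathbb{R}/\mathbb{Z}$, identified with its representative in $(0,1)$, let $[0;a_1,a_2,\dots]$ be its simple continued fraction expansion, put $p_{-1}=1$, $q_{-1}=0$, $p_0=0$, $q_0=1$, and $p_n=a_np_{n-1}+p_{n-2}$, $q_n=a_nq_{n-1}+q_{n-2}$ for $n\ge 1$ (all depending on $\alpha$). For $n\ge 1$ let $$E_n(\alpha)=\left\{\frac{mp_{n-1}+p_{n-2}}{mq_{n-1}+q_{n-2}} : m=1,2,\dots,a_n\right\},$$ regarded as a finite subset of $\mathbb{Q}/\mathbb{Z}$. Let $F:\mathbb{R}/\mathbb{Z}\to\mathbb{R}\cup\{\pm\infty\}$ be a Borel measurable function that is finite almost everywhere with respect to the normalized Haar measure. Then there exist real numbers $c(\beta)$, $\beta\in\mathbb{Q}/\mathbb{Z}$, such that $$\lim_{N\to\infty}\sum_{n=1}^N(-1)^{n-1}q_{n-1}(\alpha)\sum_{\beta\in E_n(\alpha)}c(\beta)=F(\alpha)$$ for almost all irrational points $\alpha\in\mathbb{R}/\mathbb{Z}$. -/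

import Mathlib

open MeasureTheory Filter Topology

namespace IntermediateConvergents

/-- The representative in `[0, 1)` of a point of `ℝ/ℤ`. -/
noncomputable def rep (α : UnitAddCircle) : ℝ := (AddCircle.equivIco (1 : ℝ) 0 α : ℝ)

/-- The partial quotient `a_n` of the simple continued fraction expansion of a real number `x`
(with the value `0` past the end of the expansion, which happens only for rational `x`). -/
noncomputable def partialQuotient (x : ℝ) (n : ℕ) : ℤ :=
  (GenContFract.IntFractPair.stream x n).elim 0 fun P => P.b

/-- Numerators of the principal convergents, with the index shifted by one:
`num x n` is `p_{n-1}`, so that `p_{-1} = 1`, `p_0 = a_0` and `p_n = a_n p_{n-1} + p_{n-2}`. -/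
noncomputable def num (x : ℝ) : ℕ → ℤ
  | 0 => 1
  | 1 => partialQuotient x 0
  | n + 2 => partialQuotient x (n + 1) * num x (n + 1) + num x n

/-- Denominators of the principal convergents, with the index shifted by one:
`den x n` is `q_{n-1}`, so that `q_{-1} = 0`, `q_0 = 1` and `q_n = a_n q_{n-1} + q_{n-2}`. -/
noncomputable def den (x : ℝ) : ℕ → ℤ
  | 0 => 0
  | 1 => 1
  | n + 2 => partialQuotient x (n + 1) * den x (n + 1) + den x n

open Classical in
/-- For `n ≥ 1`, the set
`E_n = { (m p_{n-1} + p_{n-2}) / (m q_{n-1} + q_{n-2}) : m = 1, …, a_n }`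
of convergents and intermediate convergents, as a finite subset of `ℚ/ℤ = AddCircle (1 : ℚ)`. -/
noncomputable def E (x : ℝ) : ℕ → Finset (AddCircle (1 : ℚ))
  | 0 => ∅
  | n + 1 => (Finset.Icc (1 : ℤ) (partialQuotient x (n + 1))).image fun m =>
      ((((m * num x (n + 1) + num x n : ℤ) : ℚ) / ((m * den x (n + 1) + den x n : ℤ) : ℚ) : ℚ) :
        AddCircle (1 : ℚ))

/-- The partial sum `∑_{n=1}^N (-1)^{n-1} q_{n-1} ∑_{β ∈ E_n} c(β)`. -/
noncomputable def partialSum (c : AddCircle (1 : ℚ) → ℝ) (x : ℝ) (N : ℕ) : ℝ :=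
  ∑ n ∈ Finset.Icc 1 N, (-1) ^ (n - 1) * (den x n : ℝ) * ∑ β ∈ E x n, c β

end IntermediateConvergents

/-! By a theorem of Lusin there is a function `G` whose derivative is `F` almost everywhere. Put
`W (p, q) = q G(p / q)`. Every `β` in `(0, 1]` is the mediant of a unique pair of Farey neighbours
`v`, `w`; let `c β = W (v + w) - W v - W w`. The `m`-th element of `E_n` is the mediant of the
`(m - 1)`-th one and of the convergent of index `n - 1`, so the sum of `c` over `E_n` telescopes to
`W (p_n, q_n) - W (p_{n-2}, q_{n-2}) - a_n W (p_{n-1}, q_{n-1})`. As `a_n q_{n-1} = q_n - q_{n-2}`,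
the sum over `n ≤ N` telescopes in turn, to the slope of `G` between the convergents of indices
`N - 1` and `N`. These lie on either side of `α` and converge to it, so the slopes tend to the
derivative `F(α)` of `G` at `α`. -/

namespace IntermediateConvergents

section Slope

variable {V : Type*}

theorem slope_mem_segment_slope [AddCommGroup V] [Module ℝ V] {f : ℝ → V} {a b x : ℝ}
    (hx : x ∈ Set.uIcc a b) : slope f a b ∈ segment ℝ (slope f x a) (slope f x b) := by
  rcases eq_or_ne a b with rfl | hab
  · obtain rfl : x = a := by simpa using hx
    exact left_mem_segment ℝ _ _
  have hne : b - a ≠ 0 := sub_ne_zero.2 hab.symm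
  obtain ⟨ha, hb⟩ : 0 ≤ (x - a) / (b - a) ∧ 0 ≤ (b - x) / (b - a) := by
    rcases Set.mem_uIcc.1 hx with ⟨hl, hr⟩ | ⟨hl, hr⟩
    · constructor <;> apply div_nonneg <;> linarith
    · constructor <;> apply div_nonneg_of_nonpos <;> linarith
  refine ⟨_, _, ha, hb, by field_simp; ring, ?_⟩
  rw [slope_comm f x a, sub_div_sub_smul_slope_add_sub_div_sub_smul_slope]

theorem tendsto_slope_of_mem_uIoo [NormedAddCommGroup V] [NormedSpace ℝ V] {ι : Type*}
    {l : Filter ι} {f : ℝ → V} {f' : V} {x : ℝ} {a b : ι → ℝ} (hf : HasDerivAt f f' x)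
    (ha : Tendsto a l (𝓝 x)) (hb : Tendsto b l (𝓝 x)) (hx : ∀ᶠ i in l, x ∈ Set.uIoo (a i) (b i)) :
    Tendsto (fun i => slope f (a i) (b i)) l (𝓝 f') := by
  have hslope {c : ι → ℝ} (hc : Tendsto c l (𝓝 x)) (hne : ∀ᶠ i in l, c i ≠ x) :
      Tendsto (fun i => slope f x (c i)) l (𝓝 f') :=
    hf.tendsto_slope.comp (tendsto_nhdsWithin_iff.2 ⟨hc, hne⟩)
  have hna : ∀ᶠ i in l, a i ≠ x := hx.mono fun i hi h => by simp [h] at hi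
  have hnb : ∀ᶠ i in l, b i ≠ x := hx.mono fun i hi h => by simp [h] at hi
  refine Metric.nhds_basis_ball.tendsto_right_iff.2 fun ε hε => ?_
  filter_upwards [hx, (hslope ha hna).eventually (Metric.ball_mem_nhds f' hε),
    (hslope hb hnb).eventually (Metric.ball_mem_nhds f' hε)] with i hi hai hbi
  exact (convex_ball f' ε).segment_subset hai hbi
    (slope_mem_segment_slope (Set.uIoo_subset_uIcc_self hi))

end Slope

section Primitive

variable {V : Type*} [NormedAddCommGroup V] [NormedSpace ℝ V]

/-- The primitive of `g` restarted from `0` at every point of the mesh `η ℤ`: it has the same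
derivative as an ordinary primitive off the mesh, but stays uniformly small. -/
noncomputable def restartedPrimitive (g : ℝ → V) {η : ℝ} (hη : 0 < η) (y : ℝ) : V :=
  ∫ t in (toIcoDiv hη 0 y • η)..y, g t

theorem ae_hasDerivAt_restartedPrimitive [CompleteSpace V] {g : ℝ → V} (hg : LocallyIntegrable g)
    {η : ℝ} (hη : 0 < η) : ∀ᵐ x, HasDerivAt (restartedPrimitive g hη) (g x) x := by
  have hmesh : ∀ᵐ x : ℝ, x ∉ Set.range fun k : ℤ => k • η :=
    (Set.countable_range _).ae_notMem volume
  filter_upwards [LocallyIntegrable.ae_hasDerivAt_integral hg, hmesh] with x hx hxη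
  have hxη' : ¬x ≡ 0 [PMOD η] := fun h => by
    obtain ⟨k, hk⟩ := AddCommGroup.modEq_iff_eq_add_zsmul.1 h.symm
    exact hxη ⟨k, by simpa using hk.symm⟩
  refine (hx (toIcoDiv hη 0 x • η)).congr_of_eventuallyEq ?_
  filter_upwards [eventuallyEq_toIcoDiv_nhds hη 0 hxη'] with y hy
  rw [restartedPrimitive, hy]

theorem norm_restartedPrimitive_le {g : ℝ → V} {C : ℝ} (hC : ∀ t, ‖g t‖ ≤ C) {η : ℝ} (hη : 0 < η)
    (y : ℝ) : ‖restartedPrimitive g hη y‖ ≤ C * η := by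
  have hC0 : 0 ≤ C := (norm_nonneg _).trans (hC 0)
  obtain ⟨hl, hr⟩ := sub_toIcoDiv_zsmul_mem_Ico hη 0 y
  calc ‖restartedPrimitive g hη y‖ ≤ C * |y - toIcoDiv hη 0 y • η| :=
        intervalIntegral.norm_integral_le_of_norm_le_const fun t _ => hC t
    _ ≤ C * η := by
        rw [abs_of_nonneg hl]
        gcongr
        simpa using hr.le

theorem restartedPrimitive_eq_zero {g : ℝ → V} {η : ℝ} (hη : 0 < η) {y : ℝ}
    (hg : ∀ t, |t - y| < η → g t = 0) : restartedPrimitive g hη y = 0 := by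
  obtain ⟨hl, hr⟩ := sub_toIcoDiv_zsmul_mem_Ico hη 0 y
  refine intervalIntegral.integral_zero_ae (ae_of_all _ fun t ht => hg t ?_)
  rw [Set.uIoc_of_le (sub_nonneg.1 hl)] at ht
  rw [abs_lt]
  constructor <;> linarith [ht.1, ht.2]

theorem exists_ae_hasDerivAt_norm_le_sq [CompleteSpace V] {g : ℝ → V} (hg : LocallyIntegrable g)
    {C : ℝ} (hC : ∀ t, ‖g t‖ ≤ C) {Q : Set ℝ} {r : ℝ} (hr : 0 < r)
    (hQ : ∀ x ∈ Q, ∀ t, |t - x| < r → g t = 0) {ε : ℝ} (hε : 0 < ε) :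
    ∃ G : ℝ → V, (∀ᵐ x, HasDerivAt G (g x) x) ∧ ∀ x ∈ Q, ∀ y, ‖G y‖ ≤ ε * (y - x) ^ 2 := by
  have hC0 : 0 ≤ C := (norm_nonneg _).trans (hC 0)
  obtain ⟨η, hη, hη_lt⟩ : ∃ η > 0, η < min (r / 2) (ε * (r / 2) ^ 2 / (C + 1)) :=
    exists_between (by positivity)
  have hηr : η < r / 2 := hη_lt.trans_le (min_le_left _ _)
  have hηC : C * η ≤ ε * (r / 2) ^ 2 := by
    have := (lt_div_iff₀ (by positivity)).1 (hη_lt.trans_le (min_le_right _ _))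
    linarith
  refine ⟨restartedPrimitive g hη, ae_hasDerivAt_restartedPrimitive hg hη, fun x hx y => ?_⟩
  rcases lt_or_ge |y - x| (r / 2) with hnear | hfar
  · rw [restartedPrimitive_eq_zero hη fun t ht => hQ x hx t ?_, norm_zero]
    · positivity
    · linarith [abs_sub_le t y x]
  · calc ‖restartedPrimitive g hη y‖ ≤ C * η := norm_restartedPrimitive_le hC hη y
      _ ≤ ε * (r / 2) ^ 2 := hηC
      _ ≤ ε * (y - x) ^ 2 := by
        rw [← sq_abs (y - x)]
        gcongr

theorem exists_ae_hasDerivAt_indicator [CompleteSpace V] {f : ℝ → V}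
    (hf : AEStronglyMeasurable f) {K Q : Set ℝ} (hK : IsCompact K) (hQ : IsClosed Q)
    (hKQ : Disjoint K Q) {C : ℝ} (hC : ∀ t ∈ K, ‖f t‖ ≤ C) {ε : ℝ} (hε : 0 < ε) :
    ∃ G : ℝ → V, (∀ᵐ x, HasDerivAt G (K.indicator f x) x) ∧
      ∀ x ∈ Q, ∀ y, ‖G y‖ ≤ ε * (y - x) ^ 2 := by
  obtain ⟨r, hr, hsep⟩ := Metric.exists_pos_forall_lt_edist hK hQ hKQ
  have hint : Integrable (K.indicator f) := by
    rw [integrable_indicator_iff hK.measurableSet]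
    exact Measure.integrableOn_of_bounded hK.measure_lt_top.ne hf
      ((ae_restrict_iff' hK.measurableSet).2 (ae_of_all _ hC))
  refine exists_ae_hasDerivAt_norm_le_sq (C := max C 0) (r := r) hint.locallyIntegrable ?_
    (by exact_mod_cast hr) (fun x hx t htx => Set.indicator_of_notMem (fun htK => ?_) f) hε
  · intro t
    by_cases ht : t ∈ K
    · simpa [ht] using Or.inl (hC t ht)
    · simp [ht]
  · have := hsep t htK x hx
    rw [edist_nndist, ENNReal.coe_lt_coe, ← NNReal.coe_lt_coe, coe_nndist, Real.dist_eq] at this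
    exact this.not_gt htx

end Primitive

theorem exists_pairwise_disjoint_isCompact_measure_sdiff_eq_zero {X : Type*} [TopologicalSpace X]
    [T2Space X] [MeasurableSpace X] [OpensMeasurableSpace X] {μ : Measure X}
    [μ.InnerRegularCompactLTTop] {A : ℕ → Set X} (hA : Monotone A)
    (hAm : ∀ n, MeasurableSet (A n)) (hμA : ∀ n, μ (A n) ≠ ⊤) :
    ∃ K : ℕ → Set X, (∀ n, IsCompact (K n)) ∧ (∀ n, K n ⊆ A n) ∧
      Pairwise (Function.onFun Disjoint K) ∧ μ ((⋃ n, A n) \ ⋃ n, K n) = 0 := by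
  have hstep (n : ℕ) (S : TopologicalSpace.Compacts X) : ∃ K : TopologicalSpace.Compacts X,
      (K : Set X) ⊆ A n \ S ∧ μ ((A n \ S) \ K) < (n + 1 : ENNReal)⁻¹ := by
    obtain ⟨K, hKA, hK, hμK⟩ := ((hAm n).diff S.isCompact.measurableSet).exists_isCompact_sdiff_lt
      (measure_ne_top_of_subset Set.sdiff_subset (hμA n))
      (ENNReal.inv_ne_zero.2 (by finiteness : (n + 1 : ENNReal) ≠ ⊤))
    exact ⟨⟨K, hK⟩, hKA, hμK⟩
  choose κ hκA hμκ using hstep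
  obtain ⟨S, hS_zero, hS_succ⟩ : ∃ S : ℕ → TopologicalSpace.Compacts X,
      S 0 = ⊥ ∧ ∀ n, S (n + 1) = S n ⊔ κ n (S n) :=
    ⟨Nat.rec ⊥ fun n S => S ⊔ κ n S, rfl, fun _ => rfl⟩
  have hS : Monotone S := monotone_nat_of_le_succ fun n => hS_succ n ▸ le_sup_left
  have hSK (n : ℕ) : (S n : Set X) ⊆ ⋃ i, (κ i (S i) : Set X) := by
    induction n with
    | zero => simp [hS_zero]
    | succ n ih =>
      rw [hS_succ, TopologicalSpace.Compacts.coe_sup]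
      exact Set.union_subset ih (Set.subset_iUnion (fun i => (κ i (S i) : Set X)) n)
  refine ⟨fun n => κ n (S n), fun n => (κ n (S n)).isCompact,
    fun n => (hκA n (S n)).trans Set.sdiff_subset, ?_, ?_⟩
  · refine (pairwise_disjoint_on _).2 fun m n hmn => ?_
    refine Set.disjoint_left.2 fun x hxm hxn => (hκA n (S n) hxn).2 ?_
    exact hS (Nat.succ_le_of_lt hmn) (hS_succ m ▸ Or.inr hxm)
  · simp only [Set.iUnion_sdiff, measure_iUnion_null_iff]
    intro m
    have hle (n : ℕ) : μ (A m \ ⋃ i, κ i (S i)) ≤ ((n + m : ℕ) + 1 : ENNReal)⁻¹ := by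
      refine (measure_mono fun x hx => ?_).trans (hμκ (n + m) (S (n + m))).le
      exact ⟨⟨hA (Nat.le_add_left m n) hx.1, fun h => hx.2 (hSK _ h)⟩,
        fun h => hx.2 (Set.mem_iUnion_of_mem _ h)⟩
    have hlim : Tendsto (fun n : ℕ => ((n + m : ℕ) + 1 : ENNReal)⁻¹) atTop (𝓝 0) := by
      have := (tendsto_add_atTop_iff_nat (m + 1)).2 ENNReal.tendsto_inv_nat_nhds_zero
      simpa [add_assoc] using this
    exact nonpos_iff_eq_zero.1 (ge_of_tendsto' hlim hle)

section Lusin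

variable {V : Type*} [NormedAddCommGroup V] [NormedSpace ℝ V] [CompleteSpace V]

theorem hasDerivAt_tsum_of_norm_le_sq {ι : Type*} {G : ι → ℝ → V} {f' : ι → V} {x : ℝ}
    (s : Finset ι) (hG : ∀ i ∈ s, HasDerivAt (G i) (f' i) x) {u : ι → ℝ} (hu : Summable u)
    (hGu : ∀ i ∉ s, ∀ y, ‖G i y‖ ≤ u i * (y - x) ^ 2) :
    HasDerivAt (fun y => ∑' i, G i y) (∑ i ∈ s, f' i) x := by
  have hus : Summable fun i : ↥(↑s : Set ι)ᶜ => u i := hu.subtype _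
  have hsum (y : ℝ) : Summable fun i => G i y := by
    refine s.summable_compl_iff.1 (.of_norm_bounded (hus.mul_right ((y - x) ^ 2)) ?_)
    exact fun i => hGu i i.2 y
  have htail : HasDerivAt (fun y => ∑' i : ↥(↑s : Set ι)ᶜ, G i y) 0 x := by
    have hO : (fun y => ∑' i : ↥(↑s : Set ι)ᶜ, G i y) =O[𝓝 x] fun y => ‖y - x‖ ^ 2 := by
      refine .of_bound (∑' i : ↥(↑s : Set ι)ᶜ, u i) (.of_forall fun y => ?_)
      rw [norm_pow, norm_norm, Real.norm_eq_abs, sq_abs]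
      exact tsum_of_norm_bounded (hus.hasSum.mul_right _) fun i => hGu i i.2 y
    simpa using (hO.hasFDerivAt (𝕜 := ℝ) one_lt_two).hasDerivAt
  have hsplit : (fun y => ∑' i, G i y) =
      fun y => ∑ i ∈ s, G i y + ∑' i : ↥(↑s : Set ι)ᶜ, G i y :=
    funext fun y => ((hsum y).sum_add_tsum_compl (s := s)).symm
  rw [hsplit]
  simpa using (HasDerivAt.fun_sum hG).fun_add htail

/-- A theorem of Lusin. The `n`-th summand of `G` is flat to second order on the earlier compact
sets, so adding it does not disturb the derivative already obtained there. -/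
theorem exists_ae_hasDerivAt {f : ℝ → V} (hf : AEStronglyMeasurable f) :
    ∃ G : ℝ → V, ∀ᵐ x, HasDerivAt G (f x) x := by
  obtain ⟨g, hg, hfg⟩ := hf
  obtain ⟨K, hK, hKA, hdisj, hnull⟩ := exists_pairwise_disjoint_isCompact_measure_sdiff_eq_zero
    (μ := (volume : Measure ℝ)) (A := fun n : ℕ => Metric.closedBall 0 n ∩ {x | ‖g x‖ ≤ n})
    (fun m n hmn => Set.inter_subset_inter (Metric.closedBall_subset_closedBall (by simpa))
      fun x (hx : ‖g x‖ ≤ m) => hx.trans (by simpa))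
    (fun n => measurableSet_closedBall.inter (hg.norm.measurable measurableSet_Iic))
    fun n => measure_ne_top_of_subset Set.inter_subset_left measure_closedBall_lt_top.ne
  have hcover : ∀ᵐ x : ℝ, ∃ m, x ∈ K m := by
    have hA : ⋃ n : ℕ, Metric.closedBall (0 : ℝ) n ∩ {x | ‖g x‖ ≤ n} = Set.univ := by
      refine Set.eq_univ_of_forall fun x => Set.mem_iUnion.2 ?_
      obtain ⟨n, hn⟩ := exists_nat_ge (max ‖x‖ ‖g x‖)
      exact ⟨n, by simpa using (le_max_left _ _).trans hn, (le_max_right _ _).trans hn⟩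
    rw [hA, ← Set.compl_eq_univ_sdiff] at hnull
    filter_upwards [compl_mem_ae_iff.2 hnull] with x hx
    exact Set.mem_iUnion.1 (not_not.1 hx)
  have hG (n : ℕ) : ∃ G : ℝ → V, (∀ᵐ x, HasDerivAt G ((K n).indicator g x) x) ∧
      ∀ x ∈ ⋃ i < n, K i, ∀ y, ‖G y‖ ≤ (1 / 2) ^ n * (y - x) ^ 2 :=
    exists_ae_hasDerivAt_indicator hg.aestronglyMeasurable (hK n)
      ((Set.finite_lt_nat n).isClosed_biUnion fun i _ => (hK i).isClosed)
      (Set.disjoint_iUnion₂_right.2 fun i hi => hdisj hi.ne') (fun t ht => (hKA n ht).2)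
      (by positivity)
  choose G hGderiv hGle using hG
  refine ⟨fun y => ∑' n, G n y, ?_⟩
  filter_upwards [hfg, hcover, ae_all_iff.2 hGderiv] with x hfx ⟨m, hxm⟩ hx
  have hsum : ∑ n ∈ Finset.range (m + 1), (K n).indicator g x = f x := by
    rw [Finset.sum_eq_single_of_mem m (Finset.self_mem_range_succ m), hfx,
      Set.indicator_of_mem hxm]
    exact fun n _ hnm => Set.indicator_of_notMem (Set.disjoint_right.1 (hdisj hnm) hxm) g
  rw [← hsum]
  refine hasDerivAt_tsum_of_norm_le_sq _ (fun n _ => hx n) summable_geometric_two fun n hn y => ?_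
  exact hGle n x (Set.mem_biUnion (show m < n by simpa using hn) hxm) y

end Lusin

section Farey

/-- The determinant of two integer vectors, read as numerators and denominators of fractions. -/
def cross (v w : ℤ × ℤ) : ℤ := v.1 * w.2 - w.1 * v.2

theorem cross_smul_add_cyclic (u v w : ℤ × ℤ) :
    cross v w • u + cross w u • v + cross u v • w = 0 := by
  ext <;> simp [cross] <;> ring

/-- The point of `ℚ/ℤ` with homogeneous coordinates `v`, that is, `v.1 / v.2`. -/
def frac (v : ℤ × ℤ) : AddCircle (1 : ℚ) := ((v.1 / v.2 : ℚ) : AddCircle (1 : ℚ))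

theorem frac_injOn : Set.InjOn frac {v | IsCoprime v.1 v.2 ∧ 0 < v.1 ∧ v.1 ≤ v.2} := by
  rintro v ⟨hv, hv0, hv1⟩ w ⟨hw, hw0, hw1⟩ h
  have hIoc {u : ℤ × ℤ} (h0 : 0 < u.1) (h1 : u.1 ≤ u.2) :
      (u.1 / u.2 : ℚ) ∈ Set.Ioc (0 : ℚ) (0 + 1) := by
    have h2 : (0 : ℚ) < u.2 := by exact_mod_cast h0.trans_le h1
    rw [zero_add]
    exact ⟨div_pos (by exact_mod_cast h0) h2, (div_le_one h2).2 (by exact_mod_cast h1)⟩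
  have hdiv : (v.1 / v.2 : ℚ) = w.1 / w.2 := by
    rw [← AddCircle.equivIoc_coe_of_mem (hIoc hv0 hv1),
      ← AddCircle.equivIoc_coe_of_mem (hIoc hw0 hw1)]
    exact congrArg (fun q => (AddCircle.equivIoc (1 : ℚ) 0 q : ℚ)) h
  exact Prod.ext_iff.2 (Rat.div_int_inj (hv0.trans_le hv1) (hw0.trans_le hw1)
    (Int.isCoprime_iff_gcd_eq_one.1 hv) (Int.isCoprime_iff_gcd_eq_one.1 hw) hdiv)

/-- Two nonnegative integer vectors spanning `ℤ²`, that is, two Farey neighbours in homogeneous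
coordinates, whose mediant lies in `(0, 1]`. The neighbours are not ordered by size, so that a
pair of consecutive convergents is a Farey pair whatever the parity of the index. -/
@[ext]
structure FareyPair where
  left : ℤ × ℤ
  right : ℤ × ℤ
  left_nonneg : 0 ≤ left
  right_nonneg : 0 ≤ right
  isUnit_cross : IsUnit (cross left right)
  mediant_le : (left + right).1 ≤ (left + right).2

namespace FareyPair

/-- The mediant of the two fractions of a Farey pair, in homogeneous coordinates. -/
def mediant (w : FareyPair) : ℤ × ℤ := w.left + w.right

/-- The Farey pair with the two fractions exchanged. -/
def swap (w : FareyPair) : FareyPair where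
  left := w.right
  right := w.left
  left_nonneg := w.right_nonneg
  right_nonneg := w.left_nonneg
  isUnit_cross := by simpa [cross] using w.isUnit_cross.neg
  mediant_le := by simpa only [add_comm] using w.mediant_le

theorem cross_swap (w : FareyPair) : cross w.swap.left w.swap.right = -cross w.left w.right := by
  simp [swap, cross]

theorem mediant_swap (w : FareyPair) : w.swap.mediant = w.mediant :=
  add_comm _ _

theorem cross_left_mediant (w : FareyPair) : cross w.left w.mediant = cross w.left w.right := by
  simp only [mediant, cross, Prod.fst_add, Prod.snd_add]
  ring

theorem right_ne_zero (w : FareyPair) : w.right ≠ 0 := fun h => by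
  simpa [cross, h] using w.isUnit_cross

theorem isCoprime_mediant (w : FareyPair) : IsCoprime w.mediant.1 w.mediant.2 := by
  obtain ⟨u, hu⟩ := w.cross_left_mediant ▸ w.isUnit_cross
  refine ⟨-↑u⁻¹ * w.left.2, ↑u⁻¹ * w.left.1, ?_⟩
  rw [← u.inv_mul, hu, cross]
  ring

theorem mediant_fst_pos (w : FareyPair) : 0 < w.mediant.1 := by
  refine lt_of_le_of_ne (add_nonneg w.left_nonneg.1 w.right_nonneg.1) fun h => ?_
  obtain ⟨hl, hr⟩ := (add_eq_zero_iff_of_nonneg w.left_nonneg.1 w.right_nonneg.1).1 h.symm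
  simpa [cross, hl, hr] using w.isUnit_cross

theorem mediant_nonneg (w : FareyPair) : 0 ≤ w.mediant :=
  add_nonneg w.left_nonneg w.right_nonneg

theorem frac_mediant_eq_iff {z w : FareyPair} :
    frac z.mediant = frac w.mediant ↔ z.mediant = w.mediant :=
  frac_injOn.eq_iff ⟨z.isCoprime_mediant, z.mediant_fst_pos, z.mediant_le⟩
    ⟨w.isCoprime_mediant, w.mediant_fst_pos, w.mediant_le⟩

theorem left_ne_left_add_zsmul_mediant {z w : FareyPair} (h : z.mediant = w.mediant) {k : ℤ}
    (hk : 0 < k) : w.left ≠ z.left + k • z.mediant := fun hw => by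
  have hright : w.right = -(z.left + (k - 1) • z.mediant) := by
    rw [sub_smul, one_smul, ← add_sub_assoc, ← hw, h, mediant]
    abel
  refine w.right_ne_zero (le_antisymm ?_ w.right_nonneg)
  rw [hright, neg_nonpos]
  exact add_nonneg z.left_nonneg (smul_nonneg (by lia) z.mediant_nonneg)

theorem eq_of_mediant_eq_of_cross_eq {z w : FareyPair} (h : z.mediant = w.mediant)
    (hcross : cross z.left z.right = cross w.left w.right) : z = w := by
  obtain ⟨k, hk⟩ : ∃ k : ℤ, w.left = z.left + k • z.mediant := by
    have hcyc := cross_smul_add_cyclic z.left w.left z.mediant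
    have hw : cross w.left z.mediant = cross w.left w.right := by rw [h, cross_left_mediant]
    have hz : cross z.mediant z.left = -cross w.left w.right := by
      rw [← hcross, ← cross_left_mediant, cross, cross]
      ring
    rw [hw, hz] at hcyc
    rcases Int.isUnit_iff.1 w.isUnit_cross with hu | hu <;> rw [hu] at hcyc
    · exact ⟨cross z.left w.left, by rw [← sub_eq_zero, ← neg_eq_zero, ← hcyc]; module⟩
    · exact ⟨-cross z.left w.left, by rw [← sub_eq_zero, ← hcyc]; module⟩
  have hleft : z.left = w.left := by
    rcases lt_trichotomy k 0 with hneg | rfl | hpos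
    · refine (left_ne_left_add_zsmul_mediant h.symm (neg_pos.2 hneg) ?_).elim
      rw [hk, ← h]
      module
    · simpa using hk.symm
    · exact (left_ne_left_add_zsmul_mediant h hpos hk).elim
  refine FareyPair.ext hleft ?_
  rw [mediant, mediant, hleft] at h
  exact add_left_cancel h

theorem eq_or_eq_swap_of_mediant_eq {z w : FareyPair} (h : z.mediant = w.mediant) :
    z = w ∨ z = w.swap := by
  have hcross : cross z.left z.right = cross w.left w.right ∨
      cross z.left z.right = cross w.swap.left w.swap.right := by
    rw [cross_swap]
    rcases Int.isUnit_iff.1 z.isUnit_cross with hz | hz <;>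
      rcases Int.isUnit_iff.1 w.isUnit_cross with hw | hw <;> simp [hz, hw]
  exact hcross.imp (eq_of_mediant_eq_of_cross_eq h)
    (eq_of_mediant_eq_of_cross_eq (h.trans w.mediant_swap.symm))

end FareyPair

variable {A : Type*} [AddCommGroup A]

/-- The failure of `W` to be additive on a Farey pair. -/
def defect (W : ℤ × ℤ → A) (w : FareyPair) : A := W w.mediant - W w.left - W w.right

theorem defect_swap (W : ℤ × ℤ → A) (w : FareyPair) : defect W w.swap = defect W w := by
  rw [defect, defect, w.mediant_swap, FareyPair.swap, sub_right_comm]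

/-- The coefficients `c` on `ℚ/ℤ` attached to a function `W` of a fraction in homogeneous
coordinates: every fraction is the mediant of a Farey pair, unique up to order, and `c` is the
additive defect of `W` on that pair. -/
noncomputable def mediantCoeff (W : ℤ × ℤ → A) : AddCircle (1 : ℚ) → A :=
  Function.extend (fun w : FareyPair => frac w.mediant) (defect W) 0

theorem mediantCoeff_frac_mediant (W : ℤ × ℤ → A) (w : FareyPair) :
    mediantCoeff W (frac w.mediant) = defect W w := by
  have hfactors : (defect W).FactorsThrough fun z : FareyPair => frac z.mediant := fun z w hzw => by
    rcases FareyPair.eq_or_eq_swap_of_mediant_eq (FareyPair.frac_mediant_eq_iff.1 hzw) with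
      rfl | rfl
    · rfl
    · exact defect_swap W w
  exact hfactors.extend_apply 0 w

end Farey

section Convergents

/-- The `n`-th convergent, indexed as in `num` and `den`, in homogeneous coordinates. -/
noncomputable def convergent (x : ℝ) (n : ℕ) : ℤ × ℤ := (num x n, den x n)

/-- The `m`-th intermediate convergent between the convergents with indices `n` and `n + 2`, in
homogeneous coordinates. -/
noncomputable def intermediate (x : ℝ) (n : ℕ) (m : ℤ) : ℤ × ℤ :=
  m • convergent x (n + 1) + convergent x n

theorem intermediate_partialQuotient (x : ℝ) (n : ℕ) :
    intermediate x n (partialQuotient x (n + 1)) = convergent x (n + 2) := by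
  simp [intermediate, convergent, num, den]

theorem E_succ_eq_image_frac (x : ℝ) (n : ℕ) : E x (n + 1) =
    (Finset.Icc 1 (partialQuotient x (n + 1))).image fun m => frac (intermediate x n m) := by
  simp [E, frac, intermediate, convergent]

theorem cross_convergent_succ (x : ℝ) (n : ℕ) :
    cross (convergent x n) (convergent x (n + 1)) = (-1) ^ n := by
  induction n with
  | zero => simp [cross, convergent, num, den]
  | succ n ih =>
    rw [pow_succ, ← ih, ← intermediate_partialQuotient]
    simp only [cross, intermediate, convergent, Prod.smul_fst, Prod.smul_snd, Prod.fst_add,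
      Prod.snd_add, smul_eq_mul]
    ring

variable {x : ℝ}

theorem exists_stream_eq_some (hx : Irrational x) (n : ℕ) :
    ∃ p, GenContFract.IntFractPair.stream x n = some p := by
  refine Option.ne_none_iff_exists'.1 fun h => ?_
  cases n with
  | zero => simp [GenContFract.IntFractPair.stream] at h
  | succ n =>
    obtain ⟨q, hq⟩ := (GenContFract.terminates_iff_rat x).1
      ⟨n, GenContFract.of_terminatedAt_n_iff_succ_nth_intFractPair_stream_eq_none.2 h⟩
    exact hx ⟨q, hq.symm⟩

theorem one_le_partialQuotient_succ (hx : Irrational x) (n : ℕ) :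
    1 ≤ partialQuotient x (n + 1) := by
  obtain ⟨p, hp⟩ := exists_stream_eq_some hx (n + 1)
  simpa [partialQuotient, hp] using GenContFract.IntFractPair.one_le_succ_nth_stream_b hp

theorem nonneg_of_partialQuotient_recurrence (hx : Irrational x) {u : ℕ → ℤ} {k : ℕ}
    (hu : ∀ n, u (n + 2) = partialQuotient x (n + k + 1) * u (n + 1) + u n)
    (h0 : 0 ≤ u 0) (h1 : 0 ≤ u 1) (n : ℕ) : 0 ≤ u n := by
  induction n using Nat.twoStepInduction with
  | zero => exact h0
  | one => exact h1
  | more n ih ih' =>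
    rw [hu]
    have := one_le_partialQuotient_succ hx (n + k)
    positivity

theorem den_nonneg (hx : Irrational x) (n : ℕ) : 0 ≤ den x n :=
  nonneg_of_partialQuotient_recurrence hx (u := den x) (k := 0) (fun _ => rfl) le_rfl zero_le_one n

theorem den_succ_pos (hx : Irrational x) (n : ℕ) : 0 < den x (n + 1) := by
  induction n with
  | zero => exact one_pos
  | succ n ih =>
    exact add_pos_of_pos_of_nonneg (mul_pos (one_le_partialQuotient_succ hx n) ih) (den_nonneg hx n)

theorem num_one_eq_zero (hx : x ∈ Set.Ioo 0 1) : num x 1 = 0 := by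
  simpa [num, partialQuotient, GenContFract.IntFractPair.stream, GenContFract.IntFractPair.of,
    Int.floor_eq_zero_iff] using Set.Ioo_subset_Ico_self hx

theorem num_nonneg (hx : Irrational x) (hx01 : x ∈ Set.Ioo 0 1) (n : ℕ) : 0 ≤ num x n :=
  nonneg_of_partialQuotient_recurrence hx (u := num x) (k := 0) (fun _ => rfl) zero_le_one
    (num_one_eq_zero hx01).ge n

theorem num_succ_le_den_succ (hx : Irrational x) (hx01 : x ∈ Set.Ioo 0 1) (n : ℕ) :
    num x (n + 1) ≤ den x (n + 1) := by
  refine sub_nonneg.1 (nonneg_of_partialQuotient_recurrence hx (k := 1)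
    (u := fun n => den x (n + 1) - num x (n + 1)) (fun n => ?_) ?_ ?_ n)
  · simp only [num, den]
    ring
  · simp [num_one_eq_zero hx01, den]
  · have hnum : num x 2 = 1 := by rw [num, num_one_eq_zero hx01, mul_zero, zero_add, num]
    simpa [hnum, den] using one_le_partialQuotient_succ hx 0

theorem num_add_num_succ_le (hx : Irrational x) (hx01 : x ∈ Set.Ioo 0 1) (n : ℕ) :
    num x n + num x (n + 1) ≤ den x n + den x (n + 1) := by
  cases n with
  | zero => rw [zero_add, num_one_eq_zero hx01, num, den, den, add_comm]
  | succ n => exact add_le_add (num_succ_le_den_succ hx hx01 n) (num_succ_le_den_succ hx hx01 _)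

theorem convergent_nonneg (hx : Irrational x) (hx01 : x ∈ Set.Ioo 0 1) (n : ℕ) :
    0 ≤ convergent x n :=
  ⟨num_nonneg hx hx01 n, den_nonneg hx n⟩

theorem intermediate_eq_add (x : ℝ) (n : ℕ) (m : ℤ) :
    intermediate x n m = convergent x (n + 1) + intermediate x n (m - 1) := by
  simp only [intermediate]
  module

/-- The Farey pair whose mediant is the `m`-th intermediate convergent. -/
noncomputable def intermediatePair (hx : Irrational x) (hx01 : x ∈ Set.Ioo 0 1) (n : ℕ) {m : ℤ}
    (hm : 1 ≤ m) : FareyPair where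
  left := convergent x (n + 1)
  right := intermediate x n (m - 1)
  left_nonneg := convergent_nonneg hx hx01 _
  right_nonneg := add_nonneg (smul_nonneg (sub_nonneg.2 hm) (convergent_nonneg hx hx01 _))
    (convergent_nonneg hx hx01 _)
  isUnit_cross := by
    have hcross : cross (convergent x (n + 1)) (intermediate x n (m - 1)) =
        -cross (convergent x n) (convergent x (n + 1)) := by
      simp only [cross, intermediate, Prod.smul_fst, Prod.smul_snd, Prod.fst_add, Prod.snd_add,
        smul_eq_mul]
      ring
    rw [hcross, cross_convergent_succ]
    exact (isUnit_one.neg.pow n).neg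
  mediant_le := by
    rw [← intermediate_eq_add]
    have hle : (m - 1) * num x (n + 1) ≤ (m - 1) * den x (n + 1) :=
      mul_le_mul_of_nonneg_left (num_succ_le_den_succ hx hx01 n) (sub_nonneg.2 hm)
    simp only [intermediate, convergent, Prod.smul_mk, Prod.mk_add_mk, smul_eq_mul]
    linarith [num_add_num_succ_le hx hx01 n]

theorem mediant_intermediatePair (hx : Irrational x) (hx01 : x ∈ Set.Ioo 0 1) (n : ℕ) {m : ℤ}
    (hm : 1 ≤ m) : (intermediatePair hx hx01 n hm).mediant = intermediate x n m :=
  (intermediate_eq_add x n m).symm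

theorem intermediate_injective (hx : Irrational x) (n : ℕ) :
    Function.Injective (intermediate x n) := fun m l h => by
  have hsnd : m * den x (n + 1) + den x n = l * den x (n + 1) + den x n := congrArg Prod.snd h
  exact mul_right_cancel₀ (den_succ_pos hx n).ne' (add_right_cancel hsnd)

theorem injOn_frac_intermediate (hx : Irrational x) (hx01 : x ∈ Set.Ioo 0 1) (n : ℕ) :
    Set.InjOn (fun m => frac (intermediate x n m)) (Set.Ici 1) := by
  intro m (hm : 1 ≤ m) l (hl : 1 ≤ l) h
  have hmediant : (intermediatePair hx hx01 n hm).mediant =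
      (intermediatePair hx hx01 n hl).mediant := by
    rw [← FareyPair.frac_mediant_eq_iff, mediant_intermediatePair, mediant_intermediatePair]
    exact h
  rw [mediant_intermediatePair, mediant_intermediatePair] at hmediant
  exact intermediate_injective hx n hmediant

end Convergents

section Telescoping

variable {A : Type*} [AddCommGroup A]

theorem sum_Icc_one_sub_pred (φ : ℤ → A) {k : ℤ} (hk : 0 ≤ k) :
    ∑ m ∈ Finset.Icc 1 k, (φ m - φ (m - 1)) = φ k - φ 0 := by
  induction k, hk using Int.leInduction with
  | base => simp
  | succ k hk ih =>
    rw [← Finset.insert_Icc_right_eq_Icc_add_one (by lia), Finset.sum_insert (by simp), ih,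
      add_sub_cancel_right, sub_add_sub_cancel]

variable {x : ℝ}

theorem sum_E_mediantCoeff (hx : Irrational x) (hx01 : x ∈ Set.Ioo 0 1) (W : ℤ × ℤ → A) (n : ℕ) :
    ∑ β ∈ E x (n + 1), mediantCoeff W β = W (convergent x (n + 2)) - W (convergent x n) -
      partialQuotient x (n + 1) • W (convergent x (n + 1)) := by
  classical
  have hpq : 0 ≤ partialQuotient x (n + 1) := zero_le_one.trans (one_le_partialQuotient_succ hx n)
  have hcoeff {m : ℤ} (hm : 1 ≤ m) : mediantCoeff W (frac (intermediate x n m)) =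
      W (intermediate x n m) - W (intermediate x n (m - 1)) - W (convergent x (n + 1)) := by
    rw [← mediant_intermediatePair hx hx01 n hm, mediantCoeff_frac_mediant, defect, sub_right_comm]
    rfl
  calc ∑ β ∈ E x (n + 1), mediantCoeff W β
      = ∑ m ∈ Finset.Icc 1 (partialQuotient x (n + 1)),
          mediantCoeff W (frac (intermediate x n m)) := by
        rw [E_succ_eq_image_frac]
        refine Finset.sum_image ((injOn_frac_intermediate hx hx01 n).mono fun m hm => ?_)
        exact (Finset.mem_Icc.1 hm).1
    _ = ∑ m ∈ Finset.Icc 1 (partialQuotient x (n + 1)),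
          (W (intermediate x n m) - W (intermediate x n (m - 1)) - W (convergent x (n + 1))) :=
        Finset.sum_congr rfl fun m hm => hcoeff (Finset.mem_Icc.1 hm).1
    _ = _ := by
        rw [Finset.sum_sub_distrib, sum_Icc_one_sub_pred (fun m => W (intermediate x n m)) hpq,
          intermediate_partialQuotient, Finset.sum_const, Int.card_Icc, add_sub_cancel_right,
          ← natCast_zsmul, Int.toNat_of_nonneg hpq, intermediate, zero_smul, zero_add]

theorem partialSum_mediantCoeff (hx : Irrational x) (hx01 : x ∈ Set.Ioo 0 1) (W : ℤ × ℤ → ℝ)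
    (N : ℕ) : partialSum (mediantCoeff W) x N =
      (-1) ^ N * (den x (N + 1) * W (convergent x N) - den x N * W (convergent x (N + 1))) -
        W (convergent x 0) := by
  induction N with
  | zero => simp [partialSum, den]
  | succ N ih =>
    rw [partialSum, Finset.sum_Icc_succ_top (by lia), ← partialSum, ih,
      sum_E_mediantCoeff hx hx01, Nat.add_sub_cancel, pow_succ, den, zsmul_eq_mul]
    push_cast
    ring

/-- The homogeneous function of degree one in numerator and denominator that agrees with `G` on
fractions of denominator `1`; it takes the value `0` at the vector `(1, 0)`. -/
noncomputable def homogenize (G : ℝ → ℝ) (v : ℤ × ℤ) : ℝ := v.2 * G (v.1 / v.2)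

theorem cross_mul_slope (G : ℝ → ℝ) {v w : ℤ × ℤ} (hv : v.2 ≠ 0) (hw : w.2 ≠ 0) :
    cross w v * slope G (v.1 / v.2) (w.1 / w.2) =
      v.2 * homogenize G w - w.2 * homogenize G v := by
  have hv' : (v.2 : ℝ) ≠ 0 := by exact_mod_cast hv
  have hw' : (w.2 : ℝ) ≠ 0 := by exact_mod_cast hw
  have hcross : (cross w v : ℝ) = v.2 * w.2 * (w.1 / w.2 - v.1 / v.2) := by
    rw [cross]
    push_cast
    field_simp
  rw [hcross, mul_assoc, ← smul_eq_mul (_ - _), sub_smul_slope, vsub_eq_sub, homogenize, homogenize]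
  ring

theorem partialSum_mediantCoeff_homogenize (hx : Irrational x) (hx01 : x ∈ Set.Ioo 0 1)
    (G : ℝ → ℝ) (n : ℕ) : partialSum (mediantCoeff (homogenize G)) x (n + 1) =
      slope G (num x (n + 1) / den x (n + 1)) (num x (n + 2) / den x (n + 2)) := by
  have hslope := cross_mul_slope G (v := convergent x (n + 2)) (w := convergent x (n + 1))
    (den_succ_pos hx (n + 1)).ne' (den_succ_pos hx n).ne'
  rw [cross_convergent_succ, slope_comm] at hslope
  have hzero : homogenize G (convergent x 0) = 0 := by simp [homogenize, convergent, den]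
  rw [partialSum_mediantCoeff hx hx01, hzero, sub_zero]
  calc _ = (-1) ^ (n + 1) * (((-1) ^ (n + 1) : ℤ) *
        slope G (num x (n + 1) / den x (n + 1)) (num x (n + 2) / den x (n + 2))) :=
        congrArg _ hslope.symm
    _ = _ := by
      push_cast
      rw [← mul_assoc, ← mul_pow, neg_one_mul, neg_neg, one_pow, one_mul]

end Telescoping

section Convergence

variable {x : ℝ}

theorem contsAux_of_irrational (hx : Irrational x) (n : ℕ) :
    (GenContFract.of x).contsAux n = ⟨num x n, den x n⟩ := by
  induction n using Nat.twoStepInduction with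
  | zero => simp [num, den]
  | one =>
    rw [GenContFract.first_contAux_eq_h_one, GenContFract.of_h_eq_floor]
    simp [num, den, partialQuotient, GenContFract.IntFractPair.stream,
      GenContFract.IntFractPair.of]
  | more n ih ih' =>
    obtain ⟨p, hp⟩ := exists_stream_eq_some hx (n + 1)
    rw [GenContFract.contsAux_recurrence
      (GenContFract.get?_of_eq_some_of_succ_get?_intFractPair_stream hp) ih ih']
    simp [num, den, partialQuotient, hp]

theorem convs_of_irrational (hx : Irrational x) (n : ℕ) :
    (GenContFract.of x).convs n = num x (n + 1) / den x (n + 1) := by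
  rw [GenContFract.conv_eq_conts_a_div_conts_b, GenContFract.nth_cont_eq_succ_nth_contAux,
    contsAux_of_irrational hx]

theorem neg_one_pow_mul_sub_convs_pos (hx : Irrational x) (n : ℕ) :
    0 < (-1) ^ n * (x - (GenContFract.of x).convs n) := by
  obtain ⟨p, hp⟩ := exists_stream_eq_some hx n
  have hfr : p.fr ≠ 0 := fun h => by
    obtain ⟨q, hq⟩ := exists_stream_eq_some hx (n + 1)
    simp [GenContFract.IntFractPair.stream_eq_none_of_fr_eq_zero hp h] at hq
  have hfr_pos : 0 < p.fr :=
    (GenContFract.IntFractPair.nth_stream_fr_nonneg_lt_one hp).1.lt_of_ne' hfr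
  have hden : (0 : ℝ) < den x (n + 1) := by exact_mod_cast den_succ_pos hx n
  have hden' : (0 : ℝ) ≤ den x n := by exact_mod_cast den_nonneg hx n
  have hsub := GenContFract.sub_convs_eq hp
  simp only [contsAux_of_irrational hx, if_neg hfr] at hsub
  rw [hsub, ← mul_div_assoc, ← mul_pow, neg_one_mul, neg_neg, one_pow]
  positivity

theorem mem_uIoo_convs (hx : Irrational x) (n : ℕ) :
    x ∈ Set.uIoo ((GenContFract.of x).convs n) ((GenContFract.of x).convs (n + 1)) := by
  have h := neg_one_pow_mul_sub_convs_pos hx n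
  have h' := neg_one_pow_mul_sub_convs_pos hx (n + 1)
  rcases neg_one_pow_eq_or ℝ n with hn | hn <;> rw [hn] at h <;> rw [pow_succ, hn] at h'
  · exact Set.mem_uIoo_of_lt (by linarith) (by linarith)
  · exact Set.mem_uIoo_of_gt (by linarith) (by linarith)

theorem tendsto_partialSum_mediantCoeff_homogenize {G : ℝ → ℝ} {g : ℝ} (hG : HasDerivAt G g x)
    (hx : Irrational x) (hx01 : x ∈ Set.Ioo 0 1) :
    Tendsto (partialSum (mediantCoeff (homogenize G)) x) atTop (𝓝 g) := by
  have hconv := GenContFract.of_convergence x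
  rw [← tendsto_add_atTop_iff_nat 1]
  simp only [partialSum_mediantCoeff_homogenize hx hx01, ← convs_of_irrational hx]
  exact tendsto_slope_of_mem_uIoo hG hconv ((tendsto_add_atTop_iff_nat 1).2 hconv)
    (.of_forall (mem_uIoo_convs hx))

end Convergence

section Circle

theorem coe_rep (α : UnitAddCircle) : (rep α : UnitAddCircle) = α :=
  AddCircle.coe_equivIco

theorem rep_coe {y : ℝ} (hy : y ∈ Set.Ico 0 1) : rep (y : UnitAddCircle) = y :=
  AddCircle.equivIco_coe_of_mem (by rwa [zero_add])

theorem rep_mem_Ioo {α : UnitAddCircle} (hα : Irrational (rep α)) : rep α ∈ Set.Ioo 0 1 := by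
  obtain ⟨h0, h1⟩ := (AddCircle.equivIco (1 : ℝ) 0 α).2
  exact ⟨h0.lt_of_ne' hα.ne_zero, h1.trans_eq (zero_add 1)⟩

theorem quasiMeasurePreserving_rep : Measure.QuasiMeasurePreserving rep := by
  have hmeas : Measurable rep :=
    measurable_subtype_coe.comp (AddCircle.measurableEquivIco 1 0).measurable
  refine ⟨hmeas, .mk fun s hs hs0 => ?_⟩
  rw [Measure.map_apply hmeas hs, AddCircle.add_projection_respects_measure 1 0 (hmeas hs)]
  refine measure_mono_null (t := s ∪ {1}) ?_ (measure_union_null hs0 (by simp))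
  rintro y ⟨hy, hy0, hy1⟩
  rw [zero_add] at hy1
  rcases hy1.eq_or_lt with rfl | hlt
  · exact Or.inr rfl
  · exact Or.inl (rep_coe ⟨hy0.le, hlt⟩ ▸ hy)

end Circle

end IntermediateConvergents

open IntermediateConvergents in
theorem theorem2 (F : UnitAddCircle → EReal) (hF : Measurable F)
    (hfin : ∀ᵐ α : UnitAddCircle ∂volume, F α ≠ ⊥ ∧ F α ≠ ⊤) :
    ∃ c : AddCircle (1 : ℚ) → ℝ,
      ∀ᵐ α : UnitAddCircle ∂volume, Irrational (IntermediateConvergents.rep α) →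
        Tendsto
          (fun N : ℕ =>
            ((IntermediateConvergents.partialSum c (IntermediateConvergents.rep α) N : ℝ) : EReal))
          atTop (𝓝 (F α)) := by
  have hf : Measurable fun y : ℝ => (F (y : UnitAddCircle)).toReal :=
    (hF.comp AddCircle.measurable_mk').ereal_toReal
  obtain ⟨G, hG⟩ := exists_ae_hasDerivAt hf.aestronglyMeasurable
  refine ⟨mediantCoeff (homogenize G), ?_⟩
  filter_upwards [hfin, quasiMeasurePreserving_rep.ae hG] with α ⟨hbot, htop⟩ hGα hα
  rw [coe_rep] at hGα
  rw [← EReal.coe_toReal htop hbot]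
  exact (continuous_coe_real_ereal.tendsto _).comp
    (tendsto_partialSum_mediantCoeff_homogenize hGα hα (rep_mem_Ioo hα))
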